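/- Let $n\ge 0$, let $V$ be the $\mathbb{C}(q)$-vector space with basis $v_1,\dots,v_n$ (the standard $U_q(\mathfrak{sl}_n)$-module), and let $T:V\otimes V\to V\otimes V$ be the $\mathbb{C}(q)$-linear map given on the basis $X_{ij}=v_i\otimes v_j$ by $$T(X_{ii})=q^{-1}X_{ii},\qquad T(X_{ij})=X_{ji},\qquad T(X_{ji})=X_{ij}-(q-q^{-1})X_{ji}\qquad (i<j)$$ (this is, up to a power of $q$, the braiding of $V$ with itself, normalized by $(T-q^{-1})(T+q)=0$). For $i=1,2,3$ let $\Psi_i:V^{\otimes 4}\to V^{\otimes 4}$ be $T$ acting in the $i$-th and $(i+1)$-st factors, and let $$\Psi=\Psi_2\Psi_1\Psi_3\Psi_2+(q-q^{-1})(\Psi_1\Psi_2\Psi_1+\Psi_1\Psi_3\Psi_2)+(q-q^{-1})^2\Psi_1\Psi_2,$$ regarded as an operator on $(V\otimes V)\otimes (V\otimes V)=V^{\otimes 4}$. Then: (i) $\Psi$ satisfies the braid equation on $(V\otimes V)^{\otimes 3}$: $$(\Psi\otimes 1)(1\otimes\Psi)(\Psi\otimes 1)=(1\otimes\Psi)(\Psi\otimes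 1)(1\otimes\Psi).$$ (ii) $(\Psi-1)(\Psi+q^2)(\Psi+q^{-2})=0$. Moreover, $\Psi$ is invertible, with $$\Psi^{-1}=\Psi_2\Psi_1\Psi_3\Psi_2+(q-q^{-1})(\Psi_2\Psi_3\Psi_2+\Psi_1\Psi_3\Psi_2)+(q-q^{-1})^2\Psi_3\Psi_2.$$ (iii) $\dim_{\mathbb{C}(q)} (\Psi-1)\big((V\otimes V)^{\otimes 2}\big)=\dim_{\mathbb{C}(q)}\Lambda^2(V\otimes V)$. -/

import Mathlib

set_option maxSynthPendingDepth 5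

open scoped TensorProduct

noncomputable section

namespace QuantumFolding

/-- The field `ℂ(q)` of rational functions. -/
abbrev K : Type := RatFunc ℂ

/-- The indeterminate `q` of `ℂ(q)`. -/
def q : K := RatFunc.X

/-- The underlying space of the standard `n`-dimensional module, with standard basis
`v_i = Pi.single i 1`. -/
abbrev V (n : ℕ) : Type := Fin n → K

/-- The space `Y = V ⊗ V`. -/
abbrev Y (n : ℕ) : Type := V n ⊗[K] V n

/-- The standard basis `X_{ij} = v_i ⊗ v_j` of `V ⊗ V`. -/
def X (n : ℕ) : Module.Basis (Fin n × Fin n) K (Y n) :=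
  (Pi.basisFun K (Fin n)).tensorProduct (Pi.basisFun K (Fin n))

/-- The normalized braiding of `V` with itself:
`T (X_{ii}) = q⁻¹ X_{ii}`, and for `i < j`,
`T (X_{ij}) = X_{ji}` and `T (X_{ji}) = X_{ij} - (q - q⁻¹) X_{ji}`. -/
def T (n : ℕ) : Module.End K (Y n) :=
  (X n).constr K fun p =>
    if p.1 = p.2 then q⁻¹ • X n (p.1, p.2)
    else if p.1 < p.2 then X n (p.2, p.1)
    else X n (p.2, p.1) - (q - q⁻¹) • X n (p.1, p.2)

/-- The rebracketing `(V ⊗ V) ⊗ (V ⊗ V) ≃ V ⊗ ((V ⊗ V) ⊗ V)`,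
`(a ⊗ b) ⊗ (c ⊗ d) ↦ a ⊗ ((b ⊗ c) ⊗ d)`. -/
def middle (n : ℕ) : (Y n ⊗[K] Y n) ≃ₗ[K] (V n ⊗[K] (Y n ⊗[K] V n)) :=
  (TensorProduct.assoc K (V n) (V n) (Y n)).trans
    (LinearEquiv.lTensor (V n) (TensorProduct.assoc K (V n) (V n) (V n)).symm)

/-- The algebra of endomorphisms of `(V ⊗ V) ⊗ (V ⊗ V)`; products are compositions. -/
abbrev EndYY (n : ℕ) : Type := Module.End K (Y n ⊗[K] Y n)

/-- `T` acting in the first and second factors of `V ⊗ V ⊗ V ⊗ V`. -/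
def Psi₁ (n : ℕ) : EndYY n :=
  LinearMap.rTensor (Y n) (T n)

/-- `T` acting in the second and third factors of `V ⊗ V ⊗ V ⊗ V`. -/
def Psi₂ (n : ℕ) : EndYY n :=
  (middle n).symm.toLinearMap ∘ₗ
    LinearMap.lTensor (V n) (LinearMap.rTensor (V n) (T n)) ∘ₗ (middle n).toLinearMap

/-- `T` acting in the third and fourth factors of `V ⊗ V ⊗ V ⊗ V`. -/
def Psi₃ (n : ℕ) : EndYY n :=
  LinearMap.lTensor (Y n) (T n)

/-- The operator `Ψ` on `(V ⊗ V) ⊗ (V ⊗ V)`; products are compositions. -/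
def Psi (n : ℕ) : EndYY n :=
  Psi₂ n * Psi₁ n * Psi₃ n * Psi₂ n
    + (q - q⁻¹) • (Psi₁ n * Psi₂ n * Psi₁ n + Psi₁ n * Psi₃ n * Psi₂ n)
    + (q - q⁻¹) ^ 2 • (Psi₁ n * Psi₂ n)

/-- The operator claimed to be the inverse of `Ψ`. -/
def PsiInv (n : ℕ) : EndYY n :=
  Psi₂ n * Psi₁ n * Psi₃ n * Psi₂ n
    + (q - q⁻¹) • (Psi₂ n * Psi₃ n * Psi₂ n + Psi₁ n * Psi₃ n * Psi₂ n)
    + (q - q⁻¹) ^ 2 • (Psi₃ n * Psi₂ n)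

/-- `F ⊗ 1` on `(Y ⊗ Y) ⊗ Y`. -/
def onLeft (n : ℕ) (F : EndYY n) :
    Module.End K ((Y n ⊗[K] Y n) ⊗[K] Y n) :=
  LinearMap.rTensor (Y n) F

/-- `1 ⊗ F` on `(Y ⊗ Y) ⊗ Y`, identified with `Y ⊗ (Y ⊗ Y)` by the associator. -/
def onRight (n : ℕ) (F : EndYY n) :
    Module.End K ((Y n ⊗[K] Y n) ⊗[K] Y n) :=
  (TensorProduct.assoc K (Y n) (Y n) (Y n)).symm.toLinearMap ∘ₗ
    LinearMap.lTensor (Y n) F ∘ₗ (TensorProduct.assoc K (Y n) (Y n) (Y n)).toLinearMap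

end QuantumFolding

end

/-! The quadratic relation gives `Ψᵢ⁻¹ = Ψᵢ + (q - q⁻¹)`, and expanding shows `Ψ = Ψ₂⁻¹Ψ₁Ψ₃⁻¹Ψ₂`
(`Psi_eq`), a mixed cabling of the braid generators. Likewise `PsiInv` is `Ψ₂⁻¹Ψ₃Ψ₁⁻¹Ψ₂`.

The braid equation is then an identity in any group satisfying the six-strand braid relations
(`braid_of_cabled`). The cubic relation holds because `Ψ` is conjugate to `Ψ₁Ψ₃⁻¹`, a ratio of
commuting operators with eigenvalues in `{q⁻¹, -q}`.

By the cubic, `(2 - Ψ - Ψ⁻¹) / (q + q⁻¹)²` is a projection onto the range of `Ψ - 1`: it takes the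
value 0 at the eigenvalue 1, and 1 at `-q²` and `-q⁻²`. So the rank `r` satisfies `(q + q⁻¹)² r =
2n⁴ - tr Ψ - tr Ψ⁻¹`. At `q = 1` both operators become the flip of `Y ⊗ Y`, of trace `n²`; hence `4r
= 2n⁴ - 2n²`, that is, `r = n²(n² - 1)/2`. -/

noncomputable section

namespace QuantumFolding

/-! ### The braid relation for cabled generators in a group. -/

section Braid

/-- In a group with elements satisfying the braid relations of six strands, the elements
`σ₂⁻¹σ₁σ₃⁻¹σ₂` and `σ₄⁻¹σ₃σ₅⁻¹σ₄` satisfy the braid relation. -/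
theorem braid_of_cabled {G : Type*} [Group G] {s₁ s₂ s₃ s₄ s₅ : G}
    (b₁₂ : s₁ * s₂ * s₁ = s₂ * s₁ * s₂) (b₂₃ : s₂ * s₃ * s₂ = s₃ * s₂ * s₃)
    (b₃₄ : s₃ * s₄ * s₃ = s₄ * s₃ * s₄) (b₄₅ : s₄ * s₅ * s₄ = s₅ * s₄ * s₅)
    (c₁₃ : Commute s₁ s₃) (c₁₄ : Commute s₁ s₄) (c₁₅ : Commute s₁ s₅)
    (c₂₄ : Commute s₂ s₄) (c₂₅ : Commute s₂ s₅) (c₃₅ : Commute s₃ s₅) :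
    (s₂⁻¹ * s₁ * s₃⁻¹ * s₂) * (s₄⁻¹ * s₃ * s₅⁻¹ * s₄) * (s₂⁻¹ * s₁ * s₃⁻¹ * s₂) =
      (s₄⁻¹ * s₃ * s₅⁻¹ * s₄) * (s₂⁻¹ * s₁ * s₃⁻¹ * s₂) * (s₄⁻¹ * s₃ * s₅⁻¹ * s₄) := by
  have pos {x y : G} (h : x * y * x = y * x * y) : SemiconjBy (x * y) x y := by
    simpa [SemiconjBy, mul_assoc] using h
  have neg {x y : G} (h : x * y * x = y * x * y) : SemiconjBy (x⁻¹ * y⁻¹) x y := by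
    rw [← mul_inv_rev, SemiconjBy.inv_symm_left_iff]
    exact pos h.symm
  -- With `A`, `B` the two cabled elements, it suffices that `AB` conjugates `A` to `B`. Each factor
  -- of this form of `AB` raises indices by one, so `AB` sends `sᵢ` to `sᵢ₊₂` for `i = 1, 2, 3`.
  have w : (s₂⁻¹ * s₁ * s₃⁻¹ * s₂) * (s₄⁻¹ * s₃ * s₅⁻¹ * s₄) =
      (s₂⁻¹ * s₃⁻¹ * s₄⁻¹ * s₅⁻¹) * (s₁ * s₂ * s₃ * s₄) := by
    calc _ = s₂⁻¹ * (s₁ * s₃⁻¹) * (s₂ * s₄⁻¹) * (s₃ * s₅⁻¹) * s₄ := by group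
      _ = s₂⁻¹ * s₃⁻¹ * (s₁ * s₄⁻¹) * (s₂ * s₅⁻¹) * s₃ * s₄ := by
        rw [c₁₃.inv_right.eq, c₂₄.inv_right.eq, c₃₅.inv_right.eq]; group
      _ = s₂⁻¹ * s₃⁻¹ * s₄⁻¹ * (s₁ * s₅⁻¹) * s₂ * s₃ * s₄ := by
        rw [c₁₄.inv_right.eq, c₂₅.inv_right.eq]; group
      _ = _ := by rw [c₁₅.inv_right.eq]; group
  have p₁ : SemiconjBy (s₁ * s₂ * s₃ * s₄) s₁ s₂ :=
    ((pos b₁₂).mul_left c₁₃.symm).mul_left c₁₄.symm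
  have p₂ : SemiconjBy (s₁ * s₂ * s₃ * s₄) s₂ s₃ := by
    have := (SemiconjBy.mul_left (a := s₁) c₁₃ (pos b₂₃)).mul_left c₂₄.symm
    simpa only [mul_assoc] using this
  have p₃ : SemiconjBy (s₁ * s₂ * s₃ * s₄) s₃ s₄ := by
    have := SemiconjBy.mul_left (a := s₁) c₁₄ (SemiconjBy.mul_left (a := s₂) c₂₄ (pos b₃₄))
    simpa only [mul_assoc] using this
  have n₂ : SemiconjBy (s₂⁻¹ * s₃⁻¹ * s₄⁻¹ * s₅⁻¹) s₂ s₃ :=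
    ((neg b₂₃).mul_left c₂₄.symm.inv_left).mul_left c₂₅.symm.inv_left
  have n₃ : SemiconjBy (s₂⁻¹ * s₃⁻¹ * s₄⁻¹ * s₅⁻¹) s₃ s₄ := by
    have := (SemiconjBy.mul_left (a := s₂⁻¹) c₂₄.inv_left (neg b₃₄)).mul_left c₃₅.symm.inv_left
    simpa only [mul_assoc] using this
  have n₄ : SemiconjBy (s₂⁻¹ * s₃⁻¹ * s₄⁻¹ * s₅⁻¹) s₄ s₅ := by
    have := SemiconjBy.mul_left (a := s₂⁻¹) c₂₅.inv_left
      (SemiconjBy.mul_left (a := s₃⁻¹) c₃₅.inv_left (neg b₄₅))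
    simpa only [mul_assoc] using this
  have t₁ := n₂.mul_left p₁
  have t₂ := n₃.mul_left p₂
  have t₃ := n₄.mul_left p₃
  rw [mul_assoc (s₄⁻¹ * s₃ * s₅⁻¹ * s₄), w]
  exact ((t₂.inv_right.mul_right t₁).mul_right t₃.inv_right).mul_right t₂

end Braid

/-! ### Algebra in a Hecke-type quotient, where `g + z • 1` is the inverse of `g`. -/

section Hecke

variable {F A : Type*} [Field F] [Ring A] [Algebra F A] {g g₁ g₂ g₃ : A} {t z : F}

theorem mul_add_smul_one_of_quadratic (h : g * g = 1 - z • g) : g * (g + z • 1) = 1 := by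
  simp [mul_add, h]

theorem add_smul_one_mul_of_quadratic (h : g * g = 1 - z • g) : (g + z • 1) * g = 1 := by
  simp [add_mul, h]

/-- The unit defined by an element `g` with `g² = 1 - z g`. -/
def heckeUnit (g : A) (z : F) (h : g * g = 1 - z • g) : Aˣ where
  val := g
  inv := g + z • 1
  val_inv := mul_add_smul_one_of_quadratic h
  inv_val := add_smul_one_mul_of_quadratic h

/-- Once the braid relation turns `g₁g₂g₁` into `g₂g₁g₂`, the left side is the expansion of
`g₂⁻¹g₁g₃⁻¹g₂`. -/
theorem cabled_eq (b : g₁ * g₂ * g₁ = g₂ * g₁ * g₂) :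
    g₂ * g₁ * g₃ * g₂ + z • (g₁ * g₂ * g₁ + g₁ * g₃ * g₂) + z ^ 2 • (g₁ * g₂) =
      (g₂ + z • 1) * g₁ * (g₃ + z • 1) * g₂ := by
  rw [b]
  simp only [add_mul, mul_add, smul_mul_assoc, mul_smul_comm, one_mul, mul_one, smul_add, pow_two,
    mul_smul]
  abel

theorem cabled_inv_eq (c : g₁ * g₃ = g₃ * g₁) :
    g₂ * g₁ * g₃ * g₂ + z • (g₂ * g₃ * g₂ + g₁ * g₃ * g₂) + z ^ 2 • (g₃ * g₂) =
      (g₂ + z • 1) * g₃ * (g₁ + z • 1) * g₂ := by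
  rw [mul_assoc g₂, c]
  simp only [add_mul, mul_add, smul_mul_assoc, mul_smul_comm, one_mul, mul_one, smul_add, pow_two,
    mul_smul, mul_assoc]
  abel

/-- The factors cancel in pairs from the middle outwards, so no relation between different `gᵢ` is
needed. -/
theorem cabled_mul_inv (h₁ : g₁ * g₁ = 1 - z • g₁) (h₂ : g₂ * g₂ = 1 - z • g₂)
    (h₃ : g₃ * g₃ = 1 - z • g₃) :
    ((g₂ + z • 1) * g₁ * (g₃ + z • 1) * g₂) * ((g₂ + z • 1) * g₃ * (g₁ + z • 1) * g₂) = 1 := by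
  calc _ = (g₂ + z • 1) * (g₁ * ((g₃ + z • 1) * (g₂ * (g₂ + z • 1)) * g₃) * (g₁ + z • 1)) * g₂ := by
        simp only [mul_assoc]
    _ = 1 := by
        rw [mul_add_smul_one_of_quadratic h₂, mul_one, add_smul_one_mul_of_quadratic h₃, mul_one,
          mul_add_smul_one_of_quadratic h₁, mul_one, add_smul_one_mul_of_quadratic h₂]

/-- The product of `g₁` and the inverse of `g₃`, when both have eigenvalues `t⁻¹` and `-t` and
commute, has eigenvalues among `1`, `-t²` and `-t⁻²`. -/
theorem ratio_cubic (ht : t ≠ 0) (c : g₁ * g₃ = g₃ * g₁)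
    (h₁ : g₁ * g₁ = 1 - (t - t⁻¹) • g₁) (h₃ : g₃ * g₃ = 1 - (t - t⁻¹) • g₃) :
    (g₁ * (g₃ + (t - t⁻¹) • 1) - 1) * (g₁ * (g₃ + (t - t⁻¹) • 1) + t ^ 2 • 1) *
      (g₁ * (g₃ + (t - t⁻¹) • 1) + (t ^ 2)⁻¹ • 1) = 0 := by
  -- These rules reduce every word to a combination of `1`, `g₁`, `g₃`, `g₁g₃`, whose coefficients
  -- are then compared.
  have e1 : ∀ x, g₁ * (g₁ * x) = x - (t - t⁻¹) • (g₁ * x) := fun x => by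
    rw [← mul_assoc, h₁]; simp [sub_mul]
  have e31 : ∀ x, g₃ * (g₁ * x) = g₁ * (g₃ * x) := fun x => by
    rw [← mul_assoc, ← c, mul_assoc]
  simp only [add_mul, mul_add, sub_mul, mul_sub, smul_mul_assoc, mul_smul_comm, one_mul, mul_one,
    smul_add, smul_sub, mul_assoc, ← c, h₁, h₃, e1, e31, smul_smul]
  match_scalars <;> field_simp <;> ring

/-- Conjugation by `g₂` carries the cubic relation for `g₁g₃⁻¹` to this one. -/
theorem cabled_cubic (ht : t ≠ 0) (c : g₁ * g₃ = g₃ * g₁)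
    (h₁ : g₁ * g₁ = 1 - (t - t⁻¹) • g₁) (h₂ : g₂ * g₂ = 1 - (t - t⁻¹) • g₂)
    (h₃ : g₃ * g₃ = 1 - (t - t⁻¹) • g₃) :
    ((g₂ + (t - t⁻¹) • 1) * g₁ * (g₃ + (t - t⁻¹) • 1) * g₂ - 1) *
      ((g₂ + (t - t⁻¹) • 1) * g₁ * (g₃ + (t - t⁻¹) • 1) * g₂ + t ^ 2 • 1) *
      ((g₂ + (t - t⁻¹) • 1) * g₁ * (g₃ + (t - t⁻¹) • 1) * g₂ + (t ^ 2)⁻¹ • 1) = 0 := by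
  have i := add_smul_one_mul_of_quadratic h₂
  have j := mul_add_smul_one_of_quadratic h₂
  have k := ratio_cubic ht c h₁ h₃
  rw [mul_assoc (g₂ + (t - t⁻¹) • 1)]
  generalize g₁ * (g₃ + (t - t⁻¹) • 1) = r at k ⊢
  generalize g₂ + (t - t⁻¹) • (1 : A) = g' at i j ⊢
  have e (s : F) : g' * r * g₂ + s • 1 = g' * (r + s • 1) * g₂ := by
    simp [mul_add, add_mul, i]
  have e1 : g' * r * g₂ - 1 = g' * (r - 1) * g₂ := by simp [mul_sub, sub_mul, i]
  rw [e, e, e1]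
  calc _ = g' * ((r - 1) * (g₂ * g') * (r + t ^ 2 • 1) * (g₂ * g') * (r + (t ^ 2)⁻¹ • 1)) * g₂ := by
        simp only [mul_assoc]
    _ = 0 := by rw [j]; simp [k]

end Hecke

/-! ### Quadratic and braid relations checked on vectors. -/

section Relations

/-- The diagonal coefficients of the braiding of the standard module, with parameter `t`. -/
def diagCoeff {F : Type*} [Field F] (t : F) {n : ℕ} (i j : Fin n) : F :=
  if i = j then t⁻¹ else if i < j then 0 else -(t - t⁻¹)

/-- The coefficients of the braiding of the standard module along the flip. -/
def flipCoeff (F : Type*) [Field F] {n : ℕ} (i j : Fin n) : F := if i = j then 0 else 1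

variable {F : Type*} [Field F] {t : F} {n : ℕ} {M : Type*} [AddCommGroup M] [Module F M]

theorem diagCoeff_smul_add_flipCoeff_smul (i j : Fin n) (x y : M) :
    diagCoeff t i j • x + flipCoeff F i j • y =
      if i = j then t⁻¹ • x else if i < j then y else y - (t - t⁻¹) • x := by
  rw [diagCoeff, flipCoeff]
  split_ifs <;> module

/-- An arbitrary family `f` stands for basis tensors with the other slots frozen, so one check
serves every position of `T`. -/
theorem quadratic_apply (ht₀ : t ≠ 0) {f : Fin n → Fin n → M} {s : Module.End F M}
    (hs : ∀ i j, s (f i j) = diagCoeff t i j • f i j + flipCoeff F i j • f j i) (i j : Fin n) :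
    s (s (f i j)) = f i j - (t - t⁻¹) • s (f i j) := by
  simp only [hs, map_add, map_smul, diagCoeff, flipCoeff]
  rcases lt_trichotomy i j with h | rfl | h
  · simp only [h.ne, h.ne', h, h.not_gt, if_true, if_false]; module
  · simp only [if_true]; match_scalars; field_simp; ring
  · simp only [h.ne, h.ne', h, h.not_gt, if_true, if_false]; module

theorem braid_apply (ht₀ : t ≠ 0) {f : Fin n → Fin n → Fin n → M} {s u : Module.End F M}
    (hs : ∀ i j k, s (f i j k) = diagCoeff t i j • f i j k + flipCoeff F i j • f j i k)
    (hu : ∀ i j k, u (f i j k) = diagCoeff t j k • f i j k + flipCoeff F j k • f i k j)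
    (i j k : Fin n) : s (u (s (f i j k))) = u (s (u (f i j k))) := by
  simp only [hs, hu, map_add, map_smul, smul_add, smul_smul, diagCoeff, flipCoeff]
  -- The coefficients depend only on the relative order of the indices; inconsistent orders are
  -- discarded by `omega`.
  rcases lt_trichotomy i j with h | h | h <;> rcases lt_trichotomy j k with h' | h' | h' <;>
    rcases lt_trichotomy i k with h'' | h'' | h''
  all_goals first
    | (exfalso; omega)
    | (try subst h
       try subst h'
       try subst h''
       simp only [*, ne_of_lt, ne_of_gt, lt_asymm, lt_irrefl, if_true, if_false] <;>
       (match_scalars <;> field_simp <;> ring))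

end Relations

/-! ### The operators on basis tensors, and the inverse and cubic relation of `Ψ`. -/

theorem q_ne_zero : q ≠ 0 := RatFunc.X_ne_zero

/-- The standard basis vector `v_i`. -/
abbrev e {n : ℕ} (i : Fin n) : V n := Pi.single i 1

theorem X_apply {n : ℕ} (p : Fin n × Fin n) : X n p = e p.1 ⊗ₜ e p.2 := by
  simp [X, Module.Basis.tensorProduct_apply', Pi.basisFun_apply]

theorem T_apply {n : ℕ} (i j : Fin n) :
    T n (e i ⊗ₜ e j) = diagCoeff q i j • (e i ⊗ₜ e j) + flipCoeff K i j • (e j ⊗ₜ e i) := by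
  have h : (e i ⊗ₜ e j : Y n) = X n (i, j) := (X_apply (i, j)).symm
  have h' : (e j ⊗ₜ e i : Y n) = X n (j, i) := (X_apply (j, i)).symm
  rw [h, h', T, Module.Basis.constr_basis, diagCoeff_smul_add_flipCoeff_smul]

/-- The standard basis vectors of `(V ⊗ V) ⊗ (V ⊗ V)`. -/
def E₄ {n : ℕ} (i j k l : Fin n) : Y n ⊗[K] Y n := (e i ⊗ₜ e j) ⊗ₜ (e k ⊗ₜ e l)

/-- The standard basis vectors of `((V ⊗ V) ⊗ (V ⊗ V)) ⊗ (V ⊗ V)`. -/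
def E₆ {n : ℕ} (i j k l m p : Fin n) : (Y n ⊗[K] Y n) ⊗[K] Y n := E₄ i j k l ⊗ₜ (e m ⊗ₜ e p)

/-- The standard basis of `(V ⊗ V) ⊗ (V ⊗ V)`. -/
def B₄ (n : ℕ) : Module.Basis ((Fin n × Fin n) × (Fin n × Fin n)) K (Y n ⊗[K] Y n) :=
  (X n).tensorProduct (X n)

theorem B₄_apply {n : ℕ} (p : (Fin n × Fin n) × (Fin n × Fin n)) :
    B₄ n p = E₄ p.1.1 p.1.2 p.2.1 p.2.2 := by
  rw [B₄, Module.Basis.tensorProduct_apply', X_apply, X_apply, E₄]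

theorem ext₄ {n : ℕ} {F G : EndYY n} (h : ∀ i j k l, F (E₄ i j k l) = G (E₄ i j k l)) : F = G :=
  (B₄ n).ext fun p => by rw [B₄_apply]; exact h _ _ _ _

theorem ext₆ {n : ℕ} {F G : Module.End K ((Y n ⊗[K] Y n) ⊗[K] Y n)}
    (h : ∀ i j k l m p, F (E₆ i j k l m p) = G (E₆ i j k l m p)) : F = G :=
  ((B₄ n).tensorProduct (X n)).ext fun p => by
    rw [Module.Basis.tensorProduct_apply', B₄_apply, X_apply]; exact h _ _ _ _ _ _

variable {n : ℕ}

theorem Psi₁_apply (i j k l : Fin n) :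
    Psi₁ n (E₄ i j k l) = diagCoeff q i j • E₄ i j k l + flipCoeff K i j • E₄ j i k l := by
  rw [Psi₁, E₄, LinearMap.rTensor_tmul, T_apply, TensorProduct.add_tmul, TensorProduct.smul_tmul',
    TensorProduct.smul_tmul']
  rfl

theorem Psi₃_apply (i j k l : Fin n) :
    Psi₃ n (E₄ i j k l) = diagCoeff q k l • E₄ i j k l + flipCoeff K k l • E₄ i j l k := by
  rw [Psi₃, E₄, LinearMap.lTensor_tmul, T_apply, TensorProduct.tmul_add, TensorProduct.tmul_smul,
    TensorProduct.tmul_smul]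
  rfl

theorem middle_apply (i j k l : Fin n) :
    middle n (E₄ i j k l) = e i ⊗ₜ ((e j ⊗ₜ e k) ⊗ₜ e l) := rfl

theorem middle_symm_apply (i j k l : Fin n) :
    (middle n).symm (e i ⊗ₜ ((e j ⊗ₜ e k) ⊗ₜ e l)) = E₄ i j k l := rfl

theorem Psi₂_apply (i j k l : Fin n) :
    Psi₂ n (E₄ i j k l) = diagCoeff q j k • E₄ i j k l + flipCoeff K j k • E₄ i k j l := by
  rw [Psi₂, LinearMap.comp_apply, LinearMap.comp_apply, LinearEquiv.coe_coe, LinearEquiv.coe_coe,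
    middle_apply, LinearMap.lTensor_tmul, LinearMap.rTensor_tmul, T_apply, TensorProduct.add_tmul,
    TensorProduct.tmul_add, ← TensorProduct.smul_tmul', ← TensorProduct.smul_tmul',
    TensorProduct.tmul_smul, TensorProduct.tmul_smul, map_add, map_smul, map_smul,
    middle_symm_apply, middle_symm_apply]

theorem Psi₁_sq : Psi₁ n * Psi₁ n = 1 - (q - q⁻¹) • Psi₁ n :=
  ext₄ fun i j k l => quadratic_apply (f := fun i j => E₄ i j k l) q_ne_zero
    (fun i j => Psi₁_apply i j k l) i j

theorem Psi₂_sq : Psi₂ n * Psi₂ n = 1 - (q - q⁻¹) • Psi₂ n :=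
  ext₄ fun i j k l => quadratic_apply (f := fun j k => E₄ i j k l) q_ne_zero
    (fun j k => Psi₂_apply i j k l) j k

theorem Psi₃_sq : Psi₃ n * Psi₃ n = 1 - (q - q⁻¹) • Psi₃ n :=
  ext₄ fun i j k l => quadratic_apply (f := fun k l => E₄ i j k l) q_ne_zero
    (fun k l => Psi₃_apply i j k l) k l

theorem Psi₁_Psi₂_braid : Psi₁ n * Psi₂ n * Psi₁ n = Psi₂ n * Psi₁ n * Psi₂ n :=
  ext₄ fun i j k l => braid_apply (f := fun i j k => E₄ i j k l) q_ne_zero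
    (fun i j k => Psi₁_apply i j k l) (fun i j k => Psi₂_apply i j k l) i j k

theorem Psi₂_Psi₃_braid : Psi₂ n * Psi₃ n * Psi₂ n = Psi₃ n * Psi₂ n * Psi₃ n :=
  ext₄ fun i j k l => braid_apply (f := fun j k l => E₄ i j k l) q_ne_zero
    (fun j k l => Psi₂_apply i j k l) (fun j k l => Psi₃_apply i j k l) j k l

theorem Psi₁_Psi₃_comm : Psi₁ n * Psi₃ n = Psi₃ n * Psi₁ n := by
  rw [Psi₁, Psi₃, Module.End.mul_eq_comp, Module.End.mul_eq_comp, LinearMap.rTensor_comp_lTensor,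
    LinearMap.lTensor_comp_rTensor]

theorem Psi_eq : Psi n =
    (Psi₂ n + (q - q⁻¹) • 1) * Psi₁ n * (Psi₃ n + (q - q⁻¹) • 1) * Psi₂ n :=
  cabled_eq Psi₁_Psi₂_braid

theorem PsiInv_eq : PsiInv n =
    (Psi₂ n + (q - q⁻¹) • 1) * Psi₃ n * (Psi₁ n + (q - q⁻¹) • 1) * Psi₂ n :=
  cabled_inv_eq Psi₁_Psi₃_comm

theorem Psi_mul_PsiInv : Psi n * PsiInv n = 1 := by
  rw [Psi_eq, PsiInv_eq]
  exact cabled_mul_inv Psi₁_sq Psi₂_sq Psi₃_sq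

theorem PsiInv_mul_Psi : PsiInv n * Psi n = 1 := by
  rw [Psi_eq, PsiInv_eq]
  exact cabled_mul_inv Psi₃_sq Psi₂_sq Psi₁_sq

theorem Psi_cubic : (Psi n - 1) * (Psi n + q ^ 2 • 1) * (Psi n + (q ^ 2)⁻¹ • 1) = 0 := by
  rw [Psi_eq]
  exact cabled_cubic q_ne_zero Psi₁_Psi₃_comm Psi₁_sq Psi₂_sq Psi₃_sq

/-! ### The braid equation on six tensor factors. -/

section SixStrands

variable {n : ℕ}

/-- `onLeft` as a monoid homomorphism. -/
def onLeftHom (n : ℕ) : EndYY n →* Module.End K ((Y n ⊗[K] Y n) ⊗[K] Y n) where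
  toFun := onLeft n
  map_one' := LinearMap.rTensor_id _ _
  map_mul' F G := LinearMap.rTensor_mul _ F G

/-- `onRight` as a monoid homomorphism. -/
def onRightHom (n : ℕ) : EndYY n →* Module.End K ((Y n ⊗[K] Y n) ⊗[K] Y n) where
  toFun := onRight n
  map_one' := LinearMap.ext fun x => by
    rw [onRight, Module.End.one_eq_id, LinearMap.lTensor_id]
    exact LinearEquiv.symm_apply_apply _ x
  map_mul' F G := LinearMap.ext fun x => by
    simp only [onRight, LinearMap.lTensor_mul, LinearMap.comp_apply, Module.End.mul_apply,
      LinearEquiv.coe_coe, LinearEquiv.apply_symm_apply]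

theorem onRight_E₆ {F : EndYY n} (i j k l m p : Fin n) :
    onRight n F (E₆ i j k l m p) =
      (TensorProduct.assoc K (Y n) (Y n) (Y n)).symm ((e i ⊗ₜ e j) ⊗ₜ F (E₄ k l m p)) := rfl

theorem assoc_symm_E₆ (i j k l m p : Fin n) :
    (TensorProduct.assoc K (Y n) (Y n) (Y n)).symm ((e i ⊗ₜ e j) ⊗ₜ E₄ k l m p) =
      E₆ i j k l m p := rfl

theorem onLeft_E₆ {F : EndYY n} (i j k l m p : Fin n) :
    onLeft n F (E₆ i j k l m p) = F (E₄ i j k l) ⊗ₜ (e m ⊗ₜ e p) := rfl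

theorem onLeft_Psi₁_apply (i j k l m p : Fin n) : onLeft n (Psi₁ n) (E₆ i j k l m p) =
    diagCoeff q i j • E₆ i j k l m p + flipCoeff K i j • E₆ j i k l m p := by
  rw [onLeft_E₆, Psi₁_apply, TensorProduct.add_tmul, ← TensorProduct.smul_tmul',
    ← TensorProduct.smul_tmul']
  rfl

theorem onLeft_Psi₂_apply (i j k l m p : Fin n) : onLeft n (Psi₂ n) (E₆ i j k l m p) =
    diagCoeff q j k • E₆ i j k l m p + flipCoeff K j k • E₆ i k j l m p := by
  rw [onLeft_E₆, Psi₂_apply, TensorProduct.add_tmul, ← TensorProduct.smul_tmul',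
    ← TensorProduct.smul_tmul']
  rfl

theorem onLeft_Psi₃_apply (i j k l m p : Fin n) : onLeft n (Psi₃ n) (E₆ i j k l m p) =
    diagCoeff q k l • E₆ i j k l m p + flipCoeff K k l • E₆ i j l k m p := by
  rw [onLeft_E₆, Psi₃_apply, TensorProduct.add_tmul, ← TensorProduct.smul_tmul',
    ← TensorProduct.smul_tmul']
  rfl

theorem onRight_Psi₁_apply (i j k l m p : Fin n) : onRight n (Psi₁ n) (E₆ i j k l m p) =
    diagCoeff q k l • E₆ i j k l m p + flipCoeff K k l • E₆ i j l k m p := by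
  rw [onRight_E₆, Psi₁_apply, TensorProduct.tmul_add, TensorProduct.tmul_smul,
    TensorProduct.tmul_smul, map_add, map_smul, map_smul, assoc_symm_E₆, assoc_symm_E₆]

theorem onRight_Psi₂_apply (i j k l m p : Fin n) : onRight n (Psi₂ n) (E₆ i j k l m p) =
    diagCoeff q l m • E₆ i j k l m p + flipCoeff K l m • E₆ i j k m l p := by
  rw [onRight_E₆, Psi₂_apply, TensorProduct.tmul_add, TensorProduct.tmul_smul,
    TensorProduct.tmul_smul, map_add, map_smul, map_smul, assoc_symm_E₆, assoc_symm_E₆]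

theorem onRight_Psi₃_apply (i j k l m p : Fin n) : onRight n (Psi₃ n) (E₆ i j k l m p) =
    diagCoeff q m p • E₆ i j k l m p + flipCoeff K m p • E₆ i j k l p m := by
  rw [onRight_E₆, Psi₃_apply, TensorProduct.tmul_add, TensorProduct.tmul_smul,
    TensorProduct.tmul_smul, map_add, map_smul, map_smul, assoc_symm_E₆, assoc_symm_E₆]

/-- Both are `T` on factors three and four: the generator shared by the two copies of the
four-strand relations. -/
theorem onLeft_Psi₃_eq : onLeft n (Psi₃ n) = onRight n (Psi₁ n) :=
  ext₆ fun i j k l m p => by rw [onLeft_Psi₃_apply, onRight_Psi₁_apply]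

theorem smul_add_smul_comm {F M : Type*} [Field F] [AddCommGroup M] [Module F M]
    (a b c d : F) (w x y z : M) :
    c • (a • w + b • x) + d • (a • y + b • z) = a • (c • w + d • y) + b • (c • x + d • z) := by
  module

theorem commute_onLeft_Psi₁_onRight_Psi₂ :
    Commute (onLeft n (Psi₁ n)) (onRight n (Psi₂ n)) :=
  ext₆ fun i j k l m p => by
    simp only [Module.End.mul_apply, onLeft_Psi₁_apply, onRight_Psi₂_apply, map_add, map_smul]
    exact smul_add_smul_comm _ _ _ _ _ _ _ _

theorem commute_onLeft_Psi₁_onRight_Psi₃ :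
    Commute (onLeft n (Psi₁ n)) (onRight n (Psi₃ n)) :=
  ext₆ fun i j k l m p => by
    simp only [Module.End.mul_apply, onLeft_Psi₁_apply, onRight_Psi₃_apply, map_add, map_smul]
    exact smul_add_smul_comm _ _ _ _ _ _ _ _

theorem commute_onLeft_Psi₂_onRight_Psi₂ :
    Commute (onLeft n (Psi₂ n)) (onRight n (Psi₂ n)) :=
  ext₆ fun i j k l m p => by
    simp only [Module.End.mul_apply, onLeft_Psi₂_apply, onRight_Psi₂_apply, map_add, map_smul]
    exact smul_add_smul_comm _ _ _ _ _ _ _ _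

theorem commute_onLeft_Psi₂_onRight_Psi₃ :
    Commute (onLeft n (Psi₂ n)) (onRight n (Psi₃ n)) :=
  ext₆ fun i j k l m p => by
    simp only [Module.End.mul_apply, onLeft_Psi₂_apply, onRight_Psi₃_apply, map_add, map_smul]
    exact smul_add_smul_comm _ _ _ _ _ _ _ _

/-- `Ψ₁` as a unit. -/
def u₁ (n : ℕ) : (EndYY n)ˣ := heckeUnit (Psi₁ n) (q - q⁻¹) Psi₁_sq

/-- `Ψ₂` as a unit. -/
def u₂ (n : ℕ) : (EndYY n)ˣ := heckeUnit (Psi₂ n) (q - q⁻¹) Psi₂_sq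

/-- `Ψ₃` as a unit. -/
def u₃ (n : ℕ) : (EndYY n)ˣ := heckeUnit (Psi₃ n) (q - q⁻¹) Psi₃_sq

theorem Psi_eq_val : Psi n = ↑((u₂ n)⁻¹ * u₁ n * (u₃ n)⁻¹ * u₂ n) := Psi_eq

theorem u₁_u₂_braid : u₁ n * u₂ n * u₁ n = u₂ n * u₁ n * u₂ n := Units.ext Psi₁_Psi₂_braid

theorem u₂_u₃_braid : u₂ n * u₃ n * u₂ n = u₃ n * u₂ n * u₃ n := Units.ext Psi₂_Psi₃_braid

theorem u₁_u₃_comm : Commute (u₁ n) (u₃ n) := Units.ext Psi₁_Psi₃_comm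

theorem Psi_braid :
    onLeft n (Psi n) * onRight n (Psi n) * onLeft n (Psi n) =
      onRight n (Psi n) * onLeft n (Psi n) * onRight n (Psi n) := by
  have key : Units.map (onLeftHom n) (u₃ n) =
      Units.map (onRightHom n) (u₁ n) := Units.ext onLeft_Psi₃_eq
  have h := braid_of_cabled (s₁ := Units.map (onLeftHom n) (u₁ n))
    (s₂ := Units.map (onLeftHom n) (u₂ n))
    (s₃ := Units.map (onLeftHom n) (u₃ n))
    (s₄ := Units.map (onRightHom n) (u₂ n))
    (s₅ := Units.map (onRightHom n) (u₃ n))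
    (by simp only [← map_mul, u₁_u₂_braid]) (by simp only [← map_mul, u₂_u₃_braid])
    (by rw [key]; simp only [← map_mul, u₁_u₂_braid]) (by simp only [← map_mul, u₂_u₃_braid])
    (u₁_u₃_comm.map _) (Units.ext commute_onLeft_Psi₁_onRight_Psi₂)
    (Units.ext commute_onLeft_Psi₁_onRight_Psi₃) (Units.ext commute_onLeft_Psi₂_onRight_Psi₂)
    (Units.ext commute_onLeft_Psi₂_onRight_Psi₃) (by rw [key]; exact u₁_u₃_comm.map _)
  have hl : Units.map (onLeftHom n) ((u₂ n)⁻¹ * u₁ n * (u₃ n)⁻¹ * u₂ n) =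
      (Units.map (onLeftHom n) (u₂ n))⁻¹ *
        Units.map (onLeftHom n) (u₁ n) *
        (Units.map (onLeftHom n) (u₃ n))⁻¹ *
        Units.map (onLeftHom n) (u₂ n) := by
    simp only [map_mul, map_inv]
  have hr : Units.map (onRightHom n) ((u₂ n)⁻¹ * u₁ n * (u₃ n)⁻¹ * u₂ n) =
      (Units.map (onRightHom n) (u₂ n))⁻¹ *
        Units.map (onLeftHom n) (u₃ n) *
        (Units.map (onRightHom n) (u₃ n))⁻¹ *
        Units.map (onRightHom n) (u₂ n) := by
    simp only [key, map_mul, map_inv]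
  rw [← hl, ← hr] at h
  rw [Psi_eq_val]
  exact congrArg Units.val h

end SixStrands

/-! ### The rank of `f - 1` from traces. -/

section Rank

variable {F W : Type*} [Field F] [AddCommGroup W] [Module F W] [FiniteDimensional F W]

/-- If `f` is invertible with inverse `g` and has eigenvalues among `1`, `-t²`, `-t⁻²`, then the
rank of `f - 1` is determined by the traces of `f` and `g`. -/
theorem sq_mul_finrank_range_sub_one {f g : Module.End F W} {t : F} (ht : t ≠ 0)
    (ht' : t + t⁻¹ ≠ 0) (hfg : f * g = 1) (hgf : g * f = 1)
    (h : (f - 1) * (f + t ^ 2 • 1) * (f + (t ^ 2)⁻¹ • 1) = 0) :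
    (t + t⁻¹) ^ 2 * (Module.finrank F (LinearMap.range (f - 1)) : F) =
      2 * (Module.finrank F W : F) - LinearMap.trace F W f - LinearMap.trace F W g := by
  have hc : (t + t⁻¹) ^ 2 ≠ 0 := pow_ne_zero 2 ht'
  set P : Module.End F W := ((t + t⁻¹) ^ 2)⁻¹ • ((2 : F) • 1 - f - g) with hP
  have e1 : (2 : F) • 1 - f - g = (f - 1) * (g - 1) := by
    simp only [mul_sub, sub_mul, hfg, mul_one, one_mul]; module
  have e2 : ((2 : F) • 1 - f - g) * (f - 1) = (t + t⁻¹) ^ 2 • (f - 1) := by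
    -- Multiplying by `g = f⁻¹` turns the cubic into a relation among `f²`, `f`, `1`, `g`, which is
    -- the claim up to sign.
    have h3 : (f - 1) * (f + t ^ 2 • 1) * (f + (t ^ 2)⁻¹ • 1) * g = 0 := by rw [h, zero_mul]
    simp only [mul_sub, sub_mul, mul_add, add_mul, hfg, hgf, smul_mul_assoc, mul_smul_comm,
      mul_one, one_mul, smul_add, smul_sub, mul_assoc] at h3 ⊢
    rw [← sub_eq_zero, ← neg_eq_zero]
    rw [← h3]
    match_scalars <;> field_simp <;> ring
  have proj : LinearMap.IsProj (LinearMap.range (f - 1)) P := by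
    refine ⟨fun x => ?_, ?_⟩
    · rw [hP, e1]
      exact Submodule.smul_mem _ _ ⟨_, rfl⟩
    · rintro _ ⟨y, rfl⟩
      rw [← Module.End.mul_apply, hP, smul_mul_assoc, e2, smul_smul, inv_mul_cancel₀ hc, one_smul]
  rw [← proj.trace, hP, map_smul, map_sub, map_sub, map_smul, LinearMap.trace_one, smul_eq_mul,
    smul_eq_mul, mul_inv_cancel_left₀ hc]

end Rank

/-! ### Evaluation at `q = 1` on rational functions regular there. -/

section Specialization

open Polynomial

/-- The rational function `x` is regular at `q = 1`, with value `c`. -/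
def HasValue (x : K) (c : ℂ) : Prop :=
  ∃ p s : ℂ[X], s.eval 1 ≠ 0 ∧ x * algebraMap ℂ[X] K s = algebraMap ℂ[X] K p ∧
    p.eval 1 = c * s.eval 1

theorem HasValue.add {x y : K} {c d : ℂ} (hx : HasValue x c) (hy : HasValue y d) :
    HasValue (x + y) (c + d) := by
  obtain ⟨p, s, hs, h, h'⟩ := hx
  obtain ⟨p₂, s₂, hs₂, h₂, h₂'⟩ := hy
  refine ⟨p * s₂ + p₂ * s, s * s₂, by simp [hs, hs₂], ?_, ?_⟩
  · simp only [map_add, map_mul, ← h, ← h₂]; ring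
  · simp only [eval_add, eval_mul, h', h₂']; ring

theorem HasValue.mul {x y : K} {c d : ℂ} (hx : HasValue x c) (hy : HasValue y d) :
    HasValue (x * y) (c * d) := by
  obtain ⟨p, s, hs, h, h'⟩ := hx
  obtain ⟨p₂, s₂, hs₂, h₂, h₂'⟩ := hy
  refine ⟨p * p₂, s * s₂, by simp [hs, hs₂], ?_, ?_⟩
  · simp only [map_mul, ← h, ← h₂]; ring
  · simp only [eval_mul, h', h₂']; ring

theorem hasValue_algebraMap (p : ℂ[X]) : HasValue (algebraMap ℂ[X] K p) (p.eval 1) :=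
  ⟨p, 1, by simp, by simp, by simp⟩

theorem hasValue_natCast (m : ℕ) : HasValue m m := by
  simpa using hasValue_algebraMap (m : ℂ[X])

theorem hasValue_zero : HasValue 0 0 := by simpa using hasValue_natCast 0

theorem hasValue_one : HasValue 1 1 := by simpa using hasValue_natCast 1

theorem HasValue.neg {x : K} {c : ℂ} (hx : HasValue x c) : HasValue (-x) (-c) := by
  have h : HasValue (-1) (-1) := by simpa using hasValue_algebraMap (-1)
  simpa using h.mul hx

theorem HasValue.sub {x y : K} {c d : ℂ} (hx : HasValue x c) (hy : HasValue y d) :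
    HasValue (x - y) (c - d) := by
  simpa [sub_eq_add_neg] using hx.add hy.neg

theorem HasValue.sum {ι : Type*} {s : Finset ι} {x : ι → K} {c : ι → ℂ}
    (h : ∀ i ∈ s, HasValue (x i) (c i)) : HasValue (∑ i ∈ s, x i) (∑ i ∈ s, c i) := by
  classical
  induction s using Finset.induction_on with
  | empty => simpa using hasValue_zero
  | insert a s ha ih =>
    rw [Finset.sum_insert ha, Finset.sum_insert ha]
    exact (h a (by simp)).add (ih fun i hi => h i (by simp [hi]))

theorem HasValue.unique {x : K} {c d : ℂ} (hx : HasValue x c) (hy : HasValue x d) : c = d := by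
  obtain ⟨p, s, hs, h, h'⟩ := hx
  obtain ⟨p₂, s₂, hs₂, h₂, h₂'⟩ := hy
  have e : p * s₂ = p₂ * s := by
    apply IsFractionRing.injective ℂ[X] K
    simp only [map_mul, ← h, ← h₂]; ring
  have e' := congrArg (eval 1) e
  simp only [eval_mul, h', h₂'] at e'
  apply mul_right_cancel₀ (mul_ne_zero hs hs₂)
  linear_combination e'

theorem hasValue_q : HasValue q 1 := by
  simpa [q, RatFunc.algebraMap_X] using hasValue_algebraMap Polynomial.X

theorem hasValue_q_inv : HasValue q⁻¹ 1 :=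
  ⟨1, Polynomial.X, by simp, by
    rw [RatFunc.algebraMap_X, map_one]; exact inv_mul_cancel₀ q_ne_zero, by simp⟩

theorem hasValue_q_sub_q_inv : HasValue (q - q⁻¹) 0 := by
  simpa using hasValue_q.sub hasValue_q_inv

/-- Its value at `q = 1` is 2. -/
theorem q_add_q_inv_ne_zero : q + q⁻¹ ≠ 0 := fun h => by
  have h₁ := hasValue_q.add hasValue_q_inv
  rw [h] at h₁
  have := h₁.unique hasValue_zero
  norm_num at this

end Specialization

/-! ### Operators whose matrix becomes that of a map of the index set at `q = 1`. -/

section Permutation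

variable {ι W : Type*} [Fintype ι] [DecidableEq ι] [AddCommGroup W] [Module K W]
  {b : Module.Basis ι K W}

/-- The matrix of `f` in the basis `b` specializes at `q = 1` to that of the map `π` on `ι`. -/
def SpecializesTo (b : Module.Basis ι K W) (f : Module.End K W) (π : ι → ι) : Prop :=
  ∀ i j, HasValue (LinearMap.toMatrix b b f i j) (if i = π j then 1 else 0)

theorem SpecializesTo.mul {f g : Module.End K W} {π ρ : ι → ι} (hf : SpecializesTo b f π)
    (hg : SpecializesTo b g ρ) : SpecializesTo b (f * g) (π ∘ ρ) := fun i j => by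
  rw [LinearMap.toMatrix_mul, Matrix.mul_apply]
  have h := HasValue.sum (s := Finset.univ) fun k _ => (hf i k).mul (hg k j)
  convert h using 1
  simp

theorem SpecializesTo.add_smul {f : Module.End K W} {π : ι → ι} (hf : SpecializesTo b f π)
    {z : K} (hz : HasValue z 0) : SpecializesTo b (f + z • 1) π := fun i j => by
  rw [map_add, map_smul, LinearMap.toMatrix_one, Matrix.add_apply, Matrix.smul_apply, smul_eq_mul,
    Matrix.one_apply]
  have h : HasValue (if i = j then (1 : K) else 0) (if i = j then 1 else 0) := by
    split_ifs
    exacts [hasValue_one, hasValue_zero]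
  simpa using (hf i j).add (hz.mul h)

/-- At `q = 1` the diagonal entry at `i` is 1 exactly when `π` fixes `i`. -/
theorem SpecializesTo.trace {f : Module.End K W} {π : ι → ι} (hf : SpecializesTo b f π) :
    HasValue (LinearMap.trace K W f) (Fintype.card {i // i = π i}) := by
  rw [LinearMap.trace_eq_matrix_trace K b, Matrix.trace]
  have h := HasValue.sum (s := Finset.univ) fun i _ => hf i i
  rwa [Finset.sum_boole, ← Fintype.card_subtype] at h

theorem specializesTo_of_apply {f : Module.End K W} {π : ι → ι} {α β : ι → K}
    (h : ∀ i, f (b i) = α i • b i + β i • b (π i)) (hα : ∀ i, π i ≠ i → HasValue (α i) 0)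
    (hβ : ∀ i, π i ≠ i → HasValue (β i) 1) (hαβ : ∀ i, π i = i → HasValue (α i + β i) 1) :
    SpecializesTo b f π := fun i j => by
  rw [LinearMap.toMatrix_apply, h, map_add, map_smul, map_smul, Finsupp.add_apply,
    Finsupp.smul_apply, Finsupp.smul_apply, b.repr_self, b.repr_self, Finsupp.single_apply,
    Finsupp.single_apply, smul_eq_mul, smul_eq_mul]
  by_cases hj : π j = j
  · rw [hj, ← add_mul]
    split_ifs with h₁ h₂ h₂
    · simpa using hαβ j hj
    · exact absurd h₁.symm h₂
    · exact absurd h₂.symm h₁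
    · simpa using hasValue_zero
  · by_cases h₁ : j = i
    · subst h₁
      simpa [hj, Ne.symm hj] using hα j hj
    · by_cases h₂ : π j = i
      · simpa [h₁, h₂] using hβ j hj
      · simpa [h₁, h₂, Ne.symm h₂] using hasValue_zero

end Permutation

/-! ### The dimension count. -/

section Dimension

variable {n : ℕ}

theorem hasValue_diagCoeff {i j : Fin n} (h : i ≠ j) : HasValue (diagCoeff q i j) 0 := by
  rw [diagCoeff, if_neg h]
  split_ifs
  · exact hasValue_zero
  · simpa using hasValue_q_sub_q_inv.neg

theorem hasValue_flipCoeff {i j : Fin n} (h : i ≠ j) : HasValue (flipCoeff K i j) 1 := by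
  rw [flipCoeff, if_neg h]
  exact hasValue_one

theorem hasValue_diagCoeff_add_flipCoeff (i : Fin n) :
    HasValue (diagCoeff q i i + flipCoeff K i i) 1 := by
  rw [diagCoeff, flipCoeff, if_pos rfl, if_pos rfl, add_zero]
  exact hasValue_q_inv

theorem specializesTo_Psi₁ :
    SpecializesTo (B₄ n) (Psi₁ n) fun p => ((p.1.2, p.1.1), (p.2.1, p.2.2)) := by
  refine specializesTo_of_apply (α := fun p => diagCoeff q p.1.1 p.1.2)
    (β := fun p => flipCoeff K p.1.1 p.1.2) (fun p => ?_) ?_ ?_ ?_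
  · simp only [B₄_apply, Psi₁_apply]
  all_goals rintro ⟨⟨i, j⟩, k, l⟩ h
  · exact hasValue_diagCoeff fun h' => h (by simp_all)
  · exact hasValue_flipCoeff fun h' => h (by simp_all)
  · obtain rfl : j = i := congrArg (fun p => p.1.1) h
    exact hasValue_diagCoeff_add_flipCoeff j

theorem specializesTo_Psi₂ :
    SpecializesTo (B₄ n) (Psi₂ n) fun p => ((p.1.1, p.2.1), (p.1.2, p.2.2)) := by
  refine specializesTo_of_apply (α := fun p => diagCoeff q p.1.2 p.2.1)
    (β := fun p => flipCoeff K p.1.2 p.2.1) (fun p => ?_) ?_ ?_ ?_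
  · simp only [B₄_apply, Psi₂_apply]
  all_goals rintro ⟨⟨i, j⟩, k, l⟩ h
  · exact hasValue_diagCoeff fun h' => h (by simp_all)
  · exact hasValue_flipCoeff fun h' => h (by simp_all)
  · obtain rfl : k = j := congrArg (fun p => p.1.2) h
    exact hasValue_diagCoeff_add_flipCoeff k

theorem specializesTo_Psi₃ :
    SpecializesTo (B₄ n) (Psi₃ n) fun p => ((p.1.1, p.1.2), (p.2.2, p.2.1)) := by
  refine specializesTo_of_apply (α := fun p => diagCoeff q p.2.1 p.2.2)
    (β := fun p => flipCoeff K p.2.1 p.2.2) (fun p => ?_) ?_ ?_ ?_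
  · simp only [B₄_apply, Psi₃_apply]
  all_goals rintro ⟨⟨i, j⟩, k, l⟩ h
  · exact hasValue_diagCoeff fun h' => h (by simp_all)
  · exact hasValue_flipCoeff fun h' => h (by simp_all)
  · obtain rfl : l = k := congrArg (fun p => p.2.1) h
    exact hasValue_diagCoeff_add_flipCoeff l

/-- At `q = 1` inverses drop out, and the transpositions (23)(12)(34)(23) compose to the exchange of
the two halves. -/
theorem specializesTo_Psi : SpecializesTo (B₄ n) (Psi n) Prod.swap := by
  rw [Psi_eq]
  exact (((specializesTo_Psi₂.add_smul hasValue_q_sub_q_inv).mul specializesTo_Psi₁).mul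
    (specializesTo_Psi₃.add_smul hasValue_q_sub_q_inv)).mul specializesTo_Psi₂

theorem specializesTo_PsiInv : SpecializesTo (B₄ n) (PsiInv n) Prod.swap := by
  rw [PsiInv_eq]
  exact (((specializesTo_Psi₂.add_smul hasValue_q_sub_q_inv).mul specializesTo_Psi₃).mul
    (specializesTo_Psi₁.add_smul hasValue_q_sub_q_inv)).mul specializesTo_Psi₂

theorem card_fixed_swap (ι : Type*) [Fintype ι] [DecidableEq ι] :
    Fintype.card {p : ι × ι // p = p.swap} = Fintype.card ι :=
  Fintype.card_congr
    { toFun := fun p => p.1.1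
      invFun := fun i => ⟨(i, i), rfl⟩
      left_inv := by
        rintro ⟨⟨i, j⟩, h⟩
        obtain rfl : i = j := congrArg Prod.fst h
        rfl
      right_inv := fun _ => rfl }

theorem finrank_Y : Module.finrank K (Y n) = n ^ 2 := by
  rw [Module.finrank_eq_card_basis (X n)]
  simp [pow_two]

theorem finrank_range_Psi_sub_one :
    Module.finrank K (LinearMap.range (Psi n - 1)) = Module.finrank K (⋀[K]^2 (Y n)) := by
  have h := sq_mul_finrank_range_sub_one q_ne_zero q_add_q_inv_ne_zero Psi_mul_PsiInv
    PsiInv_mul_Psi (Psi_cubic (n := n))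
  have hd : Module.finrank K (Y n ⊗[K] Y n) = n ^ 2 * n ^ 2 := by
    rw [Module.finrank_tensorProduct, finrank_Y]
  have t₁ := (specializesTo_Psi (n := n)).trace
  have t₂ := (specializesTo_PsiInv (n := n)).trace
  have hc : Fintype.card {p : (Fin n × Fin n) × (Fin n × Fin n) // p = p.swap} = n ^ 2 := by
    rw [card_fixed_swap]; simp [pow_two]
  rw [hc] at t₁ t₂
  rw [exteriorPower.finrank_eq, finrank_Y]
  generalize Module.finrank K (LinearMap.range (Psi n - 1)) = r at h ⊢
  have hs := hasValue_q.add hasValue_q_inv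
  have v₁ := (hs.mul hs).mul (hasValue_natCast r)
  have v₂ := (((hasValue_natCast 2).mul (hasValue_natCast (n ^ 2 * n ^ 2))).sub t₁).sub t₂
  -- The trace identity makes `v₁` and `v₂` values at `q = 1` of the same rational function, so the
  -- values agree: `4r = 2n⁴ - 2n²`.
  rw [← pow_two, h, hd] at v₁
  have key := v₁.unique v₂
  -- Stated additively to avoid truncated subtraction in `ℕ`.
  have key' : 2 * r + n ^ 2 = n ^ 2 * n ^ 2 := by
    have : (2 * r + n ^ 2 : ℂ) = n ^ 2 * n ^ 2 := by
      push_cast at key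
      linear_combination key / 2
    exact_mod_cast this
  rw [Nat.choose_two_right, Nat.mul_sub_one]
  omega

end Dimension

end QuantumFolding

end

theorem proposition1p7 (n : ℕ) :
    (QuantumFolding.onLeft n (QuantumFolding.Psi n) *
        QuantumFolding.onRight n (QuantumFolding.Psi n) *
        QuantumFolding.onLeft n (QuantumFolding.Psi n) =
      QuantumFolding.onRight n (QuantumFolding.Psi n) *
        QuantumFolding.onLeft n (QuantumFolding.Psi n) *
        QuantumFolding.onRight n (QuantumFolding.Psi n)) ∧
    ((QuantumFolding.Psi n - (1 : QuantumFolding.EndYY n)) *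
        (QuantumFolding.Psi n + (QuantumFolding.q ^ 2) • (1 : QuantumFolding.EndYY n)) *
        (QuantumFolding.Psi n + (QuantumFolding.q ^ 2)⁻¹ • (1 : QuantumFolding.EndYY n)) = 0) ∧
    (QuantumFolding.Psi n * QuantumFolding.PsiInv n = (1 : QuantumFolding.EndYY n) ∧
      QuantumFolding.PsiInv n * QuantumFolding.Psi n = (1 : QuantumFolding.EndYY n)) ∧
    Module.finrank QuantumFolding.K
        (LinearMap.range (QuantumFolding.Psi n - (1 : QuantumFolding.EndYY n))) =
      Module.finrank QuantumFolding.K (⋀[QuantumFolding.K]^2 (QuantumFolding.Y n)) :=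
  ⟨QuantumFolding.Psi_braid, QuantumFolding.Psi_cubic,
    ⟨QuantumFolding.Psi_mul_PsiInv, QuantumFolding.PsiInv_mul_Psi⟩,
    QuantumFolding.finrank_range_Psi_sub_one⟩
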